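/- **Pioneer sets define tight Bell inequalities.** Let $V$ be a finite nonempty set of observers. Observer $i\in V$ has two observables $p_i,q_i$, each with outcomes $1,2$. Put $PQ=\{p_i,q_i: i\in V\}$ and let $\Omega=\{1,2\}^{PQ}$ be the set of omni-joint outcomes. For $\sigma,\rho\subseteq V$ let $\gamma(\sigma,\rho)\in\Omega$ be the outcome in which $p_i$ has value $2$ iff $i\in\sigma\ominus\rho$ (symmetric difference) and $q_i$ has value $2$ iff $i\in\rho$; this is a bijection $\mathcal P(V)^2\to\Omega$. For $\rho\subseteq\sigma\subseteq V$ write $p_{\sigma\setminus\rho}q_\rho=\{p_i:i\in\sigma\setminus\rho\}\cup\{q_i:i\in\rho\}$, and let $\Psi$ be the collection of all these sets (sets of observables containing at most one observable per observer). *Multideviations.* For finite sets $A_b$ ($b\in B$, $B$ finite), $n_b=|A_b|$, $f:\prod_{b\in B} A_b\to\mathbb R$, $\tau\subseteq B$ and $x\in\prod_b A_b$, let $$Q^{\tau}_f(x)=\sum_{y}f(y)\,\Bigl(\prod_{b\in B} n_b\Bigr)^{-1}\prod_{b\in\tau}\bigl(n_b\delta_{x_b=y_b}-1\bigr),$$ which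 depends only on $x_\tau$; $Q^\tau_f(1)$ denotes its value when all outcomes are $1$. *TBIC.* A set $\Gamma\subseteq\Omega$ satisfies the tight Bell inequality conditions (TBIC) if (1) there is $f:\Omega\to\mathbb R$ such that (a) $f(\gamma)=0\iff\gamma\notin\Gamma$, (b) $Q_f^{\tau}(\gamma)=0$ for all $\tau\subseteq PQ$ with $\tau\notin\Psi$ and all $\gamma\in\Gamma$, and (c) $f>0$ on $\Gamma$; and (2) any two functions satisfying (1) are scalar multiples of one another. *Pioneer sets.* Let $Z$ be a partition of $V$ and, for each $z\in Z$, let $S_z\subseteq\mathcal P(z)$ be a family such that any two distinct $i,j\in z$ are joined by a finite sequence of elements of $S_z$, the first containing $i$, the last containing $j$, consecutive ones having non-empty intersection. The odd-out transform is $S_z^*=\{\mu\subseteq z: |S_z\cap\mathcal P(\mu)|\text{ is odd}\}$. The pioneer set $\mathfrak X$ of $(Z,S_Z)$ is the set of all $\gamma(\sigma,\rho)$ such that for every $z\in Z$: $\ \sigma\cap z\in S_z^*\iff|\rho\cap z|\text{ is odd}$. *Bell polytope.* For $\gamma\in\Omega$ let $G^\gamma$ be the deterministic distribution assigning to each joint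 context (a choice of one observable per observer) probability one to the outcome given by $\gamma$. The Bell polytope is the convex hull of all $G^\gamma$, in the space of families $P=(P_c)_c$ of real functions on $\{1,2\}^V$ indexed by the contexts $c$. A linear inequality $\ell(P)\ge 0$ is a tight Bell inequality if it holds on the Bell polytope and the points of the polytope with $\ell(P)=0$ form a nonempty face whose dimension is one less than that of the polytope. **Theorem.** Let $\mathfrak X$ be the pioneer set of such a pair $(Z,S_Z)$ and $f$ its indicator function on $\Omega$. Then: 1. $\mathfrak X$ satisfies the TBIC, and $f$ satisfies condition (1) for $\Gamma=\mathfrak X$. 2. For all $\rho\subseteq\sigma\subseteq V$, $$Q_f^{p_{\sigma\setminus\rho}q_\rho}(1)=\frac1{2^{|Z|}}\prod_{z\in Z}\Bigl(\delta_{z\cap\sigma=\emptyset}+\frac{1}{2^{|z|}}\,\delta_{z\setminus\sigma=\emptyset}\sum_{\mu\subseteq z}(-1)^{|\mu\setminus\rho|}(-1)^{\delta_{\mu\in S_z^*}}\Bigr).$$ 3. Put $\ell(P)=\sum_{\sigma\subseteq V}\sum_{\rho\subseteq\sigma}Q_f^{p_{\sigma\setminus\rho}q_\rho}(1)\,Q^{\sigma}_{P_{c(\rho)}}(1)$,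 where in the context $c(\rho)$ the observers in $\rho$ measure $q_i$ and the others $p_i$. For every $w:\Omega\to\mathbb R$ and $P=\sum_\gamma w(\gamma)G^\gamma$, $\ \sum_{\gamma}f(\gamma)w(\gamma)=2^{|V|}\,\ell(P)$. 4. $\ell(P)\ge 0$ is a tight Bell inequality. -/

import Mathlib

open scoped BigOperators

namespace Bell

/-! ### Multideviations of functions on a finite product set -/

section Multideviation

variable {B : Type*} [Fintype B] (A : B → Type*)
  [∀ b, Fintype (A b)] [∀ b, DecidableEq (A b)]

/-- The multideviation seed function `q^σ(x_σ, y_σ) = (1 / n_B) ∏_{i ∈ σ} (n_i δ_{x_i = y_i} - 1)`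
on the product set `∏_{b ∈ B} A_b`; it only depends on the coordinates of `x`, `y` in `σ`. -/
noncomputable def seed (σ : Finset B) (x y : ∀ b, A b) : ℝ :=
  (∏ b, (Fintype.card (A b) : ℝ))⁻¹ *
    ∏ i ∈ σ, ((Fintype.card (A i) : ℝ) * (if x i = y i then 1 else 0) - 1)

variable {A} in
/-- The `σ`-multideviation `Q^σ_f(x_σ) = ∑_y f(y) q^σ(x_σ, y_σ)`. -/
noncomputable def multideviation [DecidableEq B]
    (f : (∀ b, A b) → ℝ) (σ : Finset B) (x : ∀ b, A b) : ℝ :=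
  ∑ y, f y * seed A σ x y

end Multideviation

/-! ### Event spaces: observers `V`, observables `M i`, outcomes `N i m`

The set `∪M` of all observables is the type `Σ i, M i`. -/

section EventSpace

variable {V : Type*} (M : V → Type*) (N : ∀ i, M i → Type*)

/-- Joint measurement contexts. -/
abbrev Context : Type _ := ∀ i, M i

/-- Omni-joint outcomes: one outcome for each observable of each observer. -/
abbrev OmniOutcome : Type _ := ∀ a : (Σ i, M i), N a.1 a.2

/-- Real-valued functions on pairs of a context and a joint outcome in that context. The
multiple-context distributions live in this space. -/
abbrev Behavior : Type _ := ∀ p : Context M, (∀ i, N i (p i)) → ℝ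

variable {M}

/-- The set of observables `p_σ = {p_i : i ∈ σ}` for a context `p` and `σ ⊆ V`. -/
def restrictContext [DecidableEq V] [∀ i, DecidableEq (M i)] (p : Context M) (σ : Finset V) :
    Finset (Σ i, M i) :=
  σ.image fun i => ⟨i, p i⟩

variable (M) in
/-- `Ψ`, the collection of all sets of observables of the form `p_σ`. -/
def comeasurable [DecidableEq V] [∀ i, DecidableEq (M i)] : Set (Finset (Σ i, M i)) :=
  {τ | ∃ (p : Context M) (σ : Finset V), τ = restrictContext p σ}

variable {N}

section TBIC

variable [Fintype V] [DecidableEq V] [∀ i, Fintype (M i)] [∀ i, DecidableEq (M i)]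
  [∀ i m, Fintype (N i m)] [∀ i m, DecidableEq (N i m)]

/-- The first of the tight Bell inequality conditions, for a function `f` and a set `Γ` of
omni-joint outcomes. -/
structure TBICFunction (Γ : Set (OmniOutcome M N)) (f : OmniOutcome M N → ℝ) : Prop where
  eq_zero_iff : ∀ γ, f γ = 0 ↔ γ ∉ Γ
  multideviation_eq_zero : ∀ τ ∉ comeasurable M, ∀ γ ∈ Γ, multideviation f τ γ = 0
  pos : ∀ γ ∈ Γ, 0 < f γ

/-- The tight Bell inequality conditions for a set `Γ` of omni-joint outcomes. -/
structure TBIC (Γ : Set (OmniOutcome M N)) : Prop where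
  exists_function : ∃ f, TBICFunction Γ f
  unique : ∀ f g, TBICFunction Γ f → TBICFunction Γ g → ∃ c : ℝ, g = c • f

end TBIC

section Polytope

variable [Fintype V] [∀ i m, DecidableEq (N i m)]

/-- The deterministic, parameter-independent distribution `G^γ`. -/
def deterministic (γ : OmniOutcome M N) : Behavior M N :=
  fun p x => if x = (fun i => γ ⟨i, p i⟩) then 1 else 0

variable (M N) in
/-- The polytope of Bell distributions. -/
def bellPolytope : Set (Behavior M N) :=
  convexHull ℝ (Set.range (deterministic (M := M) (N := N)))

/-- The inequality `0 ≤ ℓ P` is a tight Bell inequality: `ℓ` is linear, the inequality holds for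
all Bell distributions, and those with equality form a facet (a nonempty face of codimension one)
of the polytope of Bell distributions. -/
structure IsTightBellInequality (ℓ : Behavior M N → ℝ) : Prop where
  linear : IsLinearMap ℝ ℓ
  valid : ∀ P ∈ bellPolytope M N, 0 ≤ ℓ P
  nonempty : {P ∈ bellPolytope M N | ℓ P = 0}.Nonempty
  facet : Module.finrank ℝ (vectorSpan ℝ {P ∈ bellPolytope M N | ℓ P = 0}) + 1 =
    Module.finrank ℝ (vectorSpan ℝ (bellPolytope M N))

end Polytope

end EventSpace

/-! ### The event space with two binary observables for each observer

Observables: `false` is `p_i`, `true` is `q_i`. Outcomes: `false` is `1`, `true` is `2`. -/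

section Binary

variable {V : Type*}

/-- The two observables of each observer. -/
abbrev BinM (V : Type*) : V → Type := fun _ => Bool

/-- The two outcomes of each observable. -/
abbrev BinN (V : Type*) : ∀ i : V, BinM V i → Type := fun _ _ => Bool

/-- Omni-joint outcomes of the binary event space. -/
abbrev BinOutcome (V : Type*) : Type _ := OmniOutcome (BinM V) (BinN V)

/-- The omni-joint outcome in which every observable has outcome `1`. -/
def allOnes (V : Type*) : BinOutcome V := fun _ => false

variable [DecidableEq V]

/-- The context in which the observers in `ρ` measure `q_i` and all others measure `p_i`. -/
def contextOf (ρ : Finset V) : Context (BinM V) := fun i => decide (i ∈ ρ)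

/-- For `ρ ⊆ σ`, the set of observables `p_{σ \ ρ} q_ρ`. -/
def pqSet (σ ρ : Finset V) : Finset (Σ i, BinM V i) := restrictContext (contextOf ρ) σ

variable [Fintype V]

/-- The correspondence between pairs `(σ, ρ)` of subsets of `V` and omni-joint outcomes: `p_i` has
outcome `2` iff `i` is in the symmetric difference of `σ` and `ρ`, and `q_i` has outcome `2` iff
`i ∈ ρ`. -/
def outcomeEquiv (V : Type*) [DecidableEq V] [Fintype V] :
    (Finset V × Finset V) ≃ BinOutcome V where
  toFun s := fun a => if a.2 = true then decide (a.1 ∈ s.2) else decide (a.1 ∈ symmDiff s.1 s.2)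
  invFun γ :=
    (Finset.univ.filter fun i => γ ⟨i, false⟩ ≠ γ ⟨i, true⟩,
      Finset.univ.filter fun i => γ ⟨i, true⟩ = true)
  left_inv := by
    rintro ⟨σ, ρ⟩
    ext i <;> by_cases h1 : i ∈ σ <;> by_cases h2 : i ∈ ρ <;> simp [Finset.mem_symmDiff, h1, h2]
  right_inv := by
    intro γ
    funext a
    obtain ⟨i, b⟩ := a
    cases b <;> cases h1 : γ ⟨i, false⟩ <;> cases h2 : γ ⟨i, true⟩ <;>
      simp [Finset.mem_symmDiff, h1, h2]

/-- The linear form of the Bell inequality attached to `f`: the sum over all sets of comeasurable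
observables `p_{σ \ ρ} q_ρ` of `Q_f · Q_P`, where `Q_P` is computed in a context that contains
these observables, and all multideviations are taken at the outcome `1`. -/
noncomputable def bellForm (f : BinOutcome V → ℝ) (P : Behavior (BinM V) (BinN V)) : ℝ :=
  ∑ σ : Finset V, ∑ ρ ∈ σ.powerset,
    multideviation f (pqSet σ ρ) (allOnes V) *
      multideviation (P (contextOf ρ)) σ (fun _ => false)

end Binary

/-! ### Pioneer sets -/

section Pioneer

variable {V : Type*} [DecidableEq V]

/-- The odd-out transform of `S ⊆ 𝒫(z)`. -/
def oddOut (z : Finset V) (S : Finset (Finset V)) : Finset (Finset V) :=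
  z.powerset.filter fun σ => Odd (S ∩ σ.powerset).card

/-- Any two distinct elements of `z` are joined by a sequence `Y 0, …, Y l` of elements of `S`,
consecutive ones having non-empty intersection. -/
def IsConnectedFamily (z : Finset V) (S : Finset (Finset V)) : Prop :=
  ∀ i ∈ z, ∀ j ∈ z, i ≠ j → ∃ (l : ℕ) (Y : ℕ → Finset V),
    (∀ k ≤ l, Y k ∈ S) ∧ i ∈ Y 0 ∧ j ∈ Y l ∧ ∀ k < l, (Y k ∩ Y (k + 1)).Nonempty

variable [Fintype V]

/-- The pairs `(Z, S_Z)` that characterize pioneer sets (`S z` matters only for `z ∈ Z`). -/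
structure IsPioneerProfile (Z : Finpartition (Finset.univ : Finset V))
    (S : Finset V → Finset (Finset V)) : Prop where
  subset : ∀ z ∈ Z.parts, S z ⊆ z.powerset
  connected : ∀ z ∈ Z.parts, IsConnectedFamily z (S z)

/-- The pioneer set of `(Z, S_Z)`. -/
def pioneerSet (Z : Finpartition (Finset.univ : Finset V)) (S : Finset V → Finset (Finset V)) :
    Set (BinOutcome V) :=
  {γ | ∃ σ ρ : Finset V, γ = outcomeEquiv V (σ, ρ) ∧
    ∀ z ∈ Z.parts, (σ ∩ z ∈ oddOut z (S z) ↔ Odd (ρ ∩ z).card)}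

end Pioneer

end Bell

/-!
Let `Ω = BinOutcome V`. A multideviation `Q^τ_f` is, up to normalization and sign, the Fourier
coefficient of `f` at the character `character τ` (`multideviation_eq`). A set of observables fails
to be comeasurable iff it contains both observables of some observer `i`, and the vanishing of all
those coefficients says that the mixed second difference of `f` in the two directions of `i` is
zero (`forall_multideviation_eq_zero_iff`). Thus the linear part of the tight Bell inequality
conditions is the local condition `Balanced`.

In the coordinates `(s, r)` of `outcomeEquiv`, with `r` viewed as a vector modulo `2`, being
balanced means that the sum of `f` over the two values of `r i` does not depend on whether `i ∈ s`,
and the pioneer set prescribes, in each block `z`, the parity of `r` as a function of `s`, namely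
the number modulo `2` of members of `S z` contained in `s`. For each `s` exactly one value of `r i`
is compatible with the prescription in the block of `i`, so the indicator is balanced. Conversely,
a balanced function that vanishes off the pioneer set is invariant under the move that changes the
membership of `i` in `s` and corrects `r i` as needed (`IsBalancedOn.move`). The commutator of the
moves in directions `i` and `j` translates `r` by `e_i + e_j` wherever the mixed second difference
of the parity function is `1`, which happens for some `s` as soon as a member of `S z` contains
`i` and `j` (`exists_parity_add_eq_one`). Connectedness of `S z` then gives all translations that
are even in each block, and together with the moves these act transitively on the pioneer set.
Hence the function is constant there (`IsBalancedOn.eq_of_isPioneer`), which gives the uniqueness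
in the tight Bell inequality conditions, without using positivity.

The coefficients are computed by factorizing the character sum over the blocks
(`sum_prod_inter_parts`, `sum_block`). The Bell form at a deterministic distribution is Fourier
inversion (`bellForm_deterministic`). For the facet, a linear functional of deterministic
distributions is balanced as a function of the outcome (`balanced_deterministic`), so one that
vanishes on the directions of the face is a multiple of the Bell form on the directions of the
polytope. The former directions are therefore the kernel of the Bell form in the latter.
-/

namespace Bell

/-! ### Fourier analysis on `B → Bool` -/

section Fourier

variable {B : Type*}

/-- The character `y ↦ ∏_{b ∈ τ} (-1)^{y_b}` of `B → Bool`, where `true` counts as `1`. -/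
def character (τ : Finset B) (y : B → Bool) : ℝ := ∏ b ∈ τ, if y b = true then -1 else 1

lemma character_ne_zero (τ : Finset B) (y : B → Bool) : character τ y ≠ 0 := by
  refine Finset.prod_ne_zero_iff.mpr fun b _ => ?_
  split_ifs <;> norm_num

@[simp] lemma character_const_false (τ : Finset B) : character τ (fun _ => false) = 1 := by
  simp [character]

lemma prod_two_delta_sub_one (τ : Finset B) (x y : B → Bool) :
    ∏ b ∈ τ, ((2 : ℝ) * (if x b = y b then 1 else 0) - 1) = character τ x * character τ y := by
  rw [character, character, ← Finset.prod_mul_distrib]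
  refine Finset.prod_congr rfl fun b _ => ?_
  cases x b <;> cases y b <;> norm_num

lemma sum_character_mul_character [Fintype B] (x y : B → Bool) :
    ∑ τ, character τ x * character τ y = if x = y then 2 ^ Fintype.card B else 0 := by
  simp_rw [← prod_two_delta_sub_one]
  rw [← Finset.powerset_univ, ← Finset.prod_one_add]
  split_ifs with h
  · subst h
    norm_num
  · obtain ⟨b, hb⟩ := Function.ne_iff.mp h
    exact Finset.prod_eq_zero (Finset.mem_univ b) (by simp [hb])

variable [DecidableEq B]

/-- The outcome `y` with its value at `b` reversed. -/
def flipAt (b : B) (y : B → Bool) : B → Bool := Function.update y b (!y b)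

lemma flipAt_involutive (b : B) : Function.Involutive (flipAt b) := by
  intro y
  simp [flipAt]

lemma flipAt_apply (a b : B) (y : B → Bool) : flipAt a y b = if b = a then !y b else y b := by
  by_cases h : b = a
  · subst h; simp [flipAt]
  · simp [flipAt, h]

lemma flipAt_comm (a b : B) (y : B → Bool) : flipAt a (flipAt b y) = flipAt b (flipAt a y) := by
  funext c
  simp only [flipAt_apply]
  split_ifs <;> rfl

lemma character_flipAt_of_mem {τ : Finset B} {b : B} (hb : b ∈ τ) (y : B → Bool) :
    character τ (flipAt b y) = -character τ y := by
  unfold character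
  rw [← Finset.mul_prod_erase _ _ hb, ← Finset.mul_prod_erase τ (fun b => ite _ _ _) hb]
  rw [← neg_mul]
  congr 1
  · cases h : y b <;> simp [flipAt_apply, h]
  · refine Finset.prod_congr rfl fun c hc => ?_
    rw [flipAt_apply, if_neg (Finset.ne_of_mem_erase hc)]

lemma character_flipAt_of_notMem {τ : Finset B} {b : B} (hb : b ∉ τ) (y : B → Bool) :
    character τ (flipAt b y) = character τ y := by
  refine Finset.prod_congr rfl fun c hc => ?_
  rw [flipAt_apply, if_neg (ne_of_mem_of_not_mem hc hb)]

variable [Fintype B]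

lemma sum_flipAt (b : B) (f : (B → Bool) → ℝ) : ∑ y, f (flipAt b y) = ∑ y, f y :=
  Equiv.sum_comp (flipAt_involutive b).toPerm f

lemma multideviation_eq (f : (B → Bool) → ℝ) (τ : Finset B) (x : B → Bool) :
    multideviation (A := fun _ => Bool) f τ x =
      (2 ^ Fintype.card B)⁻¹ * character τ x * ∑ y, f y * character τ y := by
  simp only [multideviation, seed, Fintype.card_bool, Finset.prod_const, Finset.card_univ,
    Nat.cast_ofNat, prod_two_delta_sub_one, Finset.mul_sum]
  exact Finset.sum_congr rfl fun y _ => by ring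

/-- Fourier inversion: a function is the sum of its multideviations. -/
lemma sum_multideviation (f : (B → Bool) → ℝ) (x : B → Bool) :
    ∑ τ, multideviation (A := fun _ => Bool) f τ x = f x := by
  simp_rw [multideviation_eq, Finset.mul_sum]
  rw [Finset.sum_comm]
  have : ∀ y, ∑ τ, (2 ^ Fintype.card B : ℝ)⁻¹ * character τ x * (f y * character τ y) =
      if x = y then f y else 0 := by
    intro y
    have h : ∀ τ, (2 ^ Fintype.card B : ℝ)⁻¹ * character τ x * (f y * character τ y) =
        (2 ^ Fintype.card B : ℝ)⁻¹ * f y * (character τ x * character τ y) := fun τ => by ring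
    simp_rw [h]
    rw [← Finset.mul_sum, sum_character_mul_character]
    split_ifs
    · field_simp
    · rw [mul_zero]
  simp_rw [this]
  simp

lemma multideviation_eq_zero_iff (f : (B → Bool) → ℝ) (τ : Finset B) (x : B → Bool) :
    multideviation (A := fun _ => Bool) f τ x = 0 ↔ ∑ y, f y * character τ y = 0 := by
  rw [multideviation_eq]
  simp [character_ne_zero]

lemma sum_flipAt_mul_character_of_mem {τ : Finset B} {b : B} (hb : b ∈ τ) (f : (B → Bool) → ℝ) :
    ∑ y, f (flipAt b y) * character τ y = -∑ y, f y * character τ y := by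
  rw [← sum_flipAt b, ← Finset.sum_neg_distrib]
  refine Finset.sum_congr rfl fun y _ => ?_
  rw [flipAt_involutive b y, character_flipAt_of_mem hb, mul_neg]

lemma sum_flipAt_mul_character_of_notMem {τ : Finset B} {b : B} (hb : b ∉ τ)
    (f : (B → Bool) → ℝ) :
    ∑ y, f (flipAt b y) * character τ y = ∑ y, f y * character τ y := by
  rw [← sum_flipAt b]
  refine Finset.sum_congr rfl fun y _ => ?_
  rw [flipAt_involutive b y, character_flipAt_of_notMem hb]

/-- The Fourier coefficients at all `τ` containing both `a` and `b` vanish iff the mixed second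
difference in the directions `a` and `b` vanishes. -/
lemma forall_multideviation_eq_zero_iff (f : (B → Bool) → ℝ) (a b : B) (x : B → Bool) :
    (∀ τ, a ∈ τ → b ∈ τ → multideviation (A := fun _ => Bool) f τ x = 0) ↔
      ∀ y, f y + f (flipAt a (flipAt b y)) = f (flipAt a y) + f (flipAt b y) := by
  -- the coefficient of the mixed difference, after splitting off the four terms
  have key : ∀ τ, ∑ y, (f y - f (flipAt a y) - f (flipAt b y) + f (flipAt a (flipAt b y))) *
      character τ y = if a ∈ τ ∧ b ∈ τ then 4 * ∑ y, f y * character τ y else 0 := by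
    intro τ
    simp_rw [add_mul, sub_mul, Finset.sum_add_distrib, Finset.sum_sub_distrib]
    by_cases ha : a ∈ τ <;> by_cases hb : b ∈ τ
    · rw [sum_flipAt_mul_character_of_mem hb (fun y => f (flipAt a y)),
        sum_flipAt_mul_character_of_mem ha, sum_flipAt_mul_character_of_mem hb]
      simp only [ha, hb, and_self, if_true]
      ring
    · rw [sum_flipAt_mul_character_of_notMem hb (fun y => f (flipAt a y)),
        sum_flipAt_mul_character_of_notMem hb]
      simp [hb]
    · simp_rw [flipAt_comm a b]
      rw [sum_flipAt_mul_character_of_notMem ha (fun y => f (flipAt b y)),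
        sum_flipAt_mul_character_of_notMem ha]
      simp [ha]
    · rw [sum_flipAt_mul_character_of_notMem hb (fun y => f (flipAt a y)),
        sum_flipAt_mul_character_of_notMem hb]
      simp [hb]
  simp_rw [multideviation_eq_zero_iff]
  constructor
  · intro h y
    have hz : ∑ τ, multideviation (A := fun _ => Bool)
        (fun y => f y - f (flipAt a y) - f (flipAt b y) + f (flipAt a (flipAt b y))) τ y = 0 := by
      refine Finset.sum_eq_zero fun τ _ => ?_
      rw [multideviation_eq_zero_iff, key]
      split_ifs with hab
      · rw [h τ hab.1 hab.2, mul_zero]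
      · rfl
    rw [sum_multideviation] at hz
    linarith
  · intro h τ ha hb
    have h4 := key τ
    rw [if_pos ⟨ha, hb⟩, Finset.sum_eq_zero] at h4
    · linarith
    · intro y _
      have := h y
      rw [show f y - f (flipAt a y) - f (flipAt b y) + f (flipAt a (flipAt b y)) = 0 by linarith,
        zero_mul]

end Fourier

/-! ### Functions balanced on the blocks of a pioneer profile -/

section Connectivity

open Finset

variable {V : Type*} [DecidableEq V]

/-- The number of members of `S` contained in `s`, modulo `2`. -/
def parity (S : Finset (Finset V)) (s : Finset V) : ZMod 2 := ∑ μ ∈ S, if μ ⊆ s then 1 else 0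

lemma parity_congr {z : Finset V} {S : Finset (Finset V)} (hS : S ⊆ z.powerset) {s t : Finset V}
    (h : s ∩ z = t ∩ z) : parity S s = parity S t := by
  refine sum_congr rfl fun μ hμ => ?_
  have hz : μ ⊆ z := mem_powerset.mp (hS hμ)
  have : μ ⊆ s ↔ μ ⊆ t := by
    rw [← and_iff_left (a := μ ⊆ s) hz, ← subset_inter_iff, h, subset_inter_iff,
      and_iff_left hz]
  simp only [this]

lemma symmDiff_singleton_of_notMem {s : Finset V} {k : V} (hk : k ∉ s) :
    symmDiff s {k} = insert k s := by
  ext a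
  simp only [mem_symmDiff, mem_singleton, mem_insert]
  grind

lemma symmDiff_singleton_inter {z : Finset V} {k : V} (hk : k ∉ z) (s : Finset V) :
    symmDiff s {k} ∩ z = s ∩ z := by
  ext a
  simp only [mem_inter, mem_symmDiff, mem_singleton]
  grind

/-- The mixed second difference of the parity function of `S` in the directions `i` and `j` is
not identically zero when some `μ ∈ S` contains `i` and `j`: it is `1` at `μ \ {i, j}` for a
minimal such `μ`. -/
lemma exists_parity_add_eq_one {S : Finset (Finset V)} {i j : V} (hij : i ≠ j)
    {μ : Finset V} (hμ : μ ∈ S) (hi : i ∈ μ) (hj : j ∈ μ) :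
    ∃ s, parity S s + parity S (symmDiff s {i}) + parity S (symmDiff s {j}) +
      parity S (symmDiff (symmDiff s {i}) {j}) = 1 := by
  obtain ⟨ν, hν⟩ := (S.filter fun μ => i ∈ μ ∧ j ∈ μ).exists_minimal
    ⟨μ, mem_filter.mpr ⟨hμ, hi, hj⟩⟩
  obtain ⟨hνS, hνi, hνj⟩ := mem_filter.mp hν.prop
  refine ⟨(ν.erase i).erase j, ?_⟩
  have e1 : symmDiff ((ν.erase i).erase j) {i} = ν.erase j := by
    ext a; simp only [mem_symmDiff, mem_erase, mem_singleton]; grind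
  have e2 : symmDiff ((ν.erase i).erase j) {j} = ν.erase i := by
    ext a; simp only [mem_symmDiff, mem_erase, mem_singleton]; grind
  have e3 : symmDiff (ν.erase j) {j} = ν := by
    ext a; simp only [mem_symmDiff, mem_erase, mem_singleton]; grind
  rw [e1, e2, e3]
  simp only [parity, ← sum_add_distrib]
  rw [sum_eq_single_of_mem ν hνS]
  · simp [subset_erase, hνi, hνj]
  · intro κ hκ hne
    have h2 : (1 + 1 : ZMod 2) = 0 := by decide
    simp only [subset_erase]
    by_cases hκν : κ ⊆ ν
    · -- minimality of `ν`
      have : ¬(i ∈ κ ∧ j ∈ κ) := fun h =>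
        hne (le_antisymm hκν (hν.le_of_le (mem_filter.mpr ⟨hκ, h⟩) hκν))
      by_cases hi : i ∈ κ <;> by_cases hj : j ∈ κ
      · exact absurd ⟨hi, hj⟩ this
      all_goals simp [hκν, hi, hj, h2]
    · simp [hκν]

variable [Fintype V] (Z : Finpartition (univ : Finset V)) (S : Finset V → Finset (Finset V))

/-- The pioneer condition on `(s, r)`, with the second set encoded by its indicator `r` modulo
`2`: in each block `z`, the parity of `r` is the parity of the number of members of `S z` in
`s`. -/
def IsPioneer (s : Finset V) (r : V → ZMod 2) : Prop :=
  ∀ z ∈ Z.parts, ∑ i ∈ z, r i = parity (S z) s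

/-- Vectors modulo `2` of even weight in each block: adding them to `r` keeps `(s, r)` a pioneer
pair. -/
def IsEven (v : V → ZMod 2) : Prop := ∀ z ∈ Z.parts, ∑ i ∈ z, v i = 0

variable {Z S}

lemma IsEven.add {v w : V → ZMod 2} (hv : IsEven Z v) (hw : IsEven Z w) : IsEven Z (v + w) := by
  intro z hz
  simp [sum_add_distrib, hv z hz, hw z hz]

lemma IsPioneer.add {s : Finset V} {r v : V → ZMod 2} (h : IsPioneer Z S s r)
    (hv : IsEven Z v) : IsPioneer Z S s (r + v) := by
  intro z hz
  simp [sum_add_distrib, h z hz, hv z hz]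

lemma sum_single_of_part {z z' : Finset V} (hz : z ∈ Z.parts) (hz' : z' ∈ Z.parts) {k : V}
    (hk : k ∈ z) (c : ZMod 2) : ∑ i ∈ z', (Pi.single k c : V → ZMod 2) i =
      if z' = z then c else 0 := by
  simp only [Pi.single_apply, sum_ite_eq']
  have : k ∈ z' ↔ z' = z := ⟨fun h => Z.eq_of_mem_parts hz' hz h hk, fun h => h ▸ hk⟩
  simp only [this]

lemma isEven_single_add_single {z : Finset V} (hz : z ∈ Z.parts) {i j : V} (hi : i ∈ z)
    (hj : j ∈ z) (c : ZMod 2) : IsEven Z (Pi.single i c + Pi.single j c) := by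
  intro z' hz'
  simp only [Pi.add_apply, sum_add_distrib, sum_single_of_part hz hz' hi,
    sum_single_of_part hz hz' hj]
  split_ifs
  · exact CharTwo.add_self_eq_zero c
  · exact add_zero 0

variable (Z S) in
/-- A function `h` on pairs `(s, r)` that vanishes off the pioneer pairs and whose sum over the two
values of `r i` does not depend on whether `i ∈ s`. -/
structure IsBalancedOn (h : Finset V → (V → ZMod 2) → ℝ) : Prop where
  eq_zero : ∀ s r, ¬IsPioneer Z S s r → h s r = 0
  balanced : ∀ i s r, h s r + h s (r + Pi.single i 1) =
    h (symmDiff s {i}) r + h (symmDiff s {i}) (r + Pi.single i 1)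

variable (hZS : IsPioneerProfile Z S) {h : Finset V → (V → ZMod 2) → ℝ}

include hZS

/-- Reversing the membership of `k` in `s` keeps a pioneer pair pioneer if `r k` is corrected by
the change of parity. -/
lemma IsPioneer.move {s : Finset V} {r : V → ZMod 2} (hsr : IsPioneer Z S s r) {z : Finset V}
    (hz : z ∈ Z.parts) {k : V} (hk : k ∈ z) :
    IsPioneer Z S (symmDiff s {k})
      (r + Pi.single k (parity (S z) s + parity (S z) (symmDiff s {k}))) := by
  intro z' hz'
  simp only [Pi.add_apply, sum_add_distrib, sum_single_of_part hz hz' hk, hsr z' hz']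
  split_ifs with hzz
  · subst hzz
    rw [← add_assoc, CharTwo.add_self_eq_zero, zero_add]
  · have hk' : k ∉ z' := fun h => hzz (Z.eq_of_mem_parts hz' hz h hk)
    rw [add_zero, parity_congr (hZS.subset z' hz') (symmDiff_singleton_inter hk' s)]

omit hZS in
lemma not_isPioneer_add_single {s : Finset V} {r : V → ZMod 2} (hsr : IsPioneer Z S s r)
    {z : Finset V} (hz : z ∈ Z.parts) {k : V} (hk : k ∈ z) :
    ¬IsPioneer Z S s (r + Pi.single k 1) := by
  intro h
  have := h z hz
  simp only [Pi.add_apply, sum_add_distrib, sum_single_of_part hz hz hk, hsr z hz] at this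
  simp at this

/-- A balanced function takes the same value before and after a move: on each side of the
balance equation exactly one of the two arguments is a pioneer pair. -/
lemma IsBalancedOn.move (hh : IsBalancedOn Z S h) {s : Finset V} {r : V → ZMod 2}
    (hsr : IsPioneer Z S s r) {z : Finset V} (hz : z ∈ Z.parts) {k : V} (hk : k ∈ z) :
    h (symmDiff s {k}) (r + Pi.single k (parity (S z) s + parity (S z) (symmDiff s {k}))) =
      h s r := by
  have hm := hsr.move hZS hz hk
  have h1 := hh.balanced k s r
  rw [hh.eq_zero s _ (not_isPioneer_add_single hsr hz hk), add_zero] at h1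
  have h2 := hh.eq_zero _ _ (not_isPioneer_add_single hm hz hk)
  have hc : ∀ c : ZMod 2, c = 0 ∨ c = 1 := by decide
  rw [h1]
  generalize parity (S z) s + parity (S z) (symmDiff s {k}) = c at h2 ⊢
  rcases hc c with rfl | rfl
  · simp only [Pi.single_zero, add_zero] at h2 ⊢
    rw [h2, add_zero]
  · rw [add_assoc, ← Pi.single_add, CharTwo.add_self_eq_zero, Pi.single_zero, add_zero] at h2
    rw [h2, zero_add]

/-- Invariance of `h` under an even translation of `r` can be checked for a single `s`. -/
lemma translate_of_translate (hh : IsBalancedOn Z S h) {v : V → ZMod 2} (hv : IsEven Z v)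
    {s : Finset V} (hs : ∀ r, IsPioneer Z S s r → h s (r + v) = h s r) (t : Finset V) :
    ∀ r, IsPioneer Z S t r → h t (r + v) = h t r := by
  have step : ∀ s k, (∀ r, IsPioneer Z S s r → h s (r + v) = h s r) →
      ∀ r, IsPioneer Z S (symmDiff s {k}) r →
        h (symmDiff s {k}) (r + v) = h (symmDiff s {k}) r := by
    intro s k hs r hr
    have hz : Z.part k ∈ Z.parts := Z.part_mem.mpr (mem_univ k)
    have hk : k ∈ Z.part k := Z.mem_part_self.mpr (mem_univ k)
    have h1 := hr.move hZS hz hk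
    have h2 := hh.move hZS hr hz hk
    have h3 := hh.move hZS (hr.add hv) hz hk
    rw [symmDiff_symmDiff_cancel_right] at h1 h2 h3
    rw [← h2, ← h3, add_right_comm, hs _ h1]
  have all : ∀ u : Finset V, ∀ r, IsPioneer Z S (symmDiff s u) r →
      h (symmDiff s u) (r + v) = h (symmDiff s u) r := by
    intro u
    induction u using Finset.induction with
    | empty => rwa [show (∅ : Finset V) = ⊥ from rfl, symmDiff_bot]
    | insert a u ha ih =>
      rw [← symmDiff_singleton_of_notMem ha, ← symmDiff_assoc]
      exact step _ a ih
  simpa using all (symmDiff s t)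

/-- The commutator of the moves in the directions `i` and `j` translates `r` by `e_i + e_j` where
the mixed second difference of the parity function is `1`. -/
lemma translate_of_mem (hh : IsBalancedOn Z S h) {z : Finset V} (hz : z ∈ Z.parts)
    {i j : V} (hij : i ≠ j) {μ : Finset V} (hμ : μ ∈ S z) (hi : i ∈ μ) (hj : j ∈ μ)
    (s : Finset V) (r : V → ZMod 2) (hsr : IsPioneer Z S s r) :
    h s (r + (Pi.single i 1 + Pi.single j 1)) = h s r := by
  have hμz : μ ⊆ z := mem_powerset.mp (hZS.subset z hz hμ)
  have hiz := hμz hi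
  have hjz := hμz hj
  obtain ⟨s₀, hs₀⟩ := exists_parity_add_eq_one hij hμ hi hj
  refine translate_of_translate hZS hh (isEven_single_add_single hz hiz hjz 1) (s := s₀) ?_ s r hsr
  intro r hr
  have m1 := hr.move hZS hz hiz
  have m2 := m1.move hZS hz hjz
  have m3 := m2.move hZS hz hiz
  have h1 := hh.move hZS hr hz hiz
  have h2 := hh.move hZS m1 hz hjz
  have h3 := hh.move hZS m2 hz hiz
  have h4 := hh.move hZS m3 hz hjz
  have e : symmDiff (symmDiff (symmDiff s₀ {i}) {j}) {i} = symmDiff s₀ {j} := by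
    rw [symmDiff_right_comm, symmDiff_symmDiff_cancel_right]
  rw [e] at h3 h4
  rw [symmDiff_symmDiff_cancel_right] at h4
  rw [← h1, ← h2, ← h3, ← h4]
  congr 1
  generalize parity (S z) s₀ = c₀ at hs₀ ⊢
  generalize parity (S z) (symmDiff s₀ {i}) = c₁ at hs₀ ⊢
  generalize parity (S z) (symmDiff s₀ {j}) = c₂ at hs₀ ⊢
  generalize parity (S z) (symmDiff (symmDiff s₀ {i}) {j}) = c₃ at hs₀ ⊢
  have t1 : (1 : ZMod 2) = (c₀ + c₁) + (c₃ + c₂) := by rw [← hs₀]; ring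
  have t2 : (1 : ZMod 2) = (c₁ + c₃) + (c₂ + c₀) := by rw [← hs₀]; ring
  conv_lhs => rw [show (Pi.single i (1 : ZMod 2) : V → ZMod 2) =
    Pi.single i (c₀ + c₁) + Pi.single i (c₃ + c₂) by rw [← Pi.single_add, ← t1],
    show (Pi.single j (1 : ZMod 2) : V → ZMod 2) =
    Pi.single j (c₁ + c₃) + Pi.single j (c₂ + c₀) by rw [← Pi.single_add, ← t2]]
  abel

/-- The connectedness of `S z` extends `translate_of_mem` to all pairs in the block `z`. -/
lemma translate_of_block (hh : IsBalancedOn Z S h) {z : Finset V} (hz : z ∈ Z.parts)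
    {i j : V} (hi : i ∈ z) (hj : j ∈ z) (s : Finset V) (r : V → ZMod 2)
    (hsr : IsPioneer Z S s r) :
    h s (r + (Pi.single i 1 + Pi.single j 1)) = h s r := by
  have hself : ∀ k : V, (Pi.single k 1 + Pi.single k 1 : V → ZMod 2) = 0 := fun k => by
    rw [← Pi.single_add, CharTwo.add_self_eq_zero, Pi.single_zero]
  have edge : ∀ μ ∈ S z, ∀ a ∈ μ, ∀ b ∈ μ, ∀ r, IsPioneer Z S s r →
      h s (r + (Pi.single a 1 + Pi.single b 1)) = h s r := by
    intro μ hμ a ha b hb r hr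
    rcases eq_or_ne a b with rfl | hab
    · rw [hself, add_zero]
    · exact translate_of_mem hZS hh hz hab hμ ha hb s r hr
  rcases eq_or_ne i j with rfl | hij
  · rw [hself, add_zero]
  obtain ⟨l, Y, hY, hi0, hjl, hne⟩ := hZS.connected z hz i hi j hj hij
  have chain : ∀ k ≤ l, ∀ b ∈ Y k, ∀ r, IsPioneer Z S s r →
      h s (r + (Pi.single i 1 + Pi.single b 1)) = h s r := by
    intro k
    induction k with
    | zero => exact fun hk b hb r hr => edge _ (hY 0 hk) i hi0 b hb r hr
    | succ k ih =>
      intro hk b hb r hr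
      obtain ⟨a, ha⟩ := hne k hk
      obtain ⟨ha1, ha2⟩ := mem_inter.mp ha
      have haz : a ∈ z := mem_powerset.mp (hZS.subset z hz (hY _ hk)) ha2
      rw [← ih (by omega) a ha1 r hr, ← edge _ (hY _ hk) a ha2 b hb
        _ (hr.add (isEven_single_add_single hz hi haz 1))]
      congr 1
      rw [← add_zero (r + _), ← hself a]
      abel
  exact chain l le_rfl j hjl r hsr

/-- Even translations are sums of the translations `e_i + e_j` with `i`, `j` in one block. -/
lemma translate_of_isEven (hh : IsBalancedOn Z S h) {v : V → ZMod 2} (hv : IsEven Z v)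
    (s : Finset V) (r : V → ZMod 2) (hsr : IsPioneer Z S s r) : h s (r + v) = h s r := by
  rcases isEmpty_or_nonempty V with _ | _
  · rw [Subsingleton.elim v 0, add_zero]
  choose! rep hrep using fun z (hz : z ∈ Z.parts) => Z.nonempty_of_mem_parts hz
  have hsum : v = ∑ z ∈ Z.parts, ∑ i ∈ z, (Pi.single i (v i) + Pi.single (rep z) (v i)) := by
    have h0 : ∀ z ∈ Z.parts, ∑ i ∈ z, (Pi.single (rep z) (v i) : V → ZMod 2) = 0 := by
      intro z hz
      have := map_sum (AddMonoidHom.single (fun _ : V => ZMod 2) (rep z)) v z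
      rw [hv z hz, map_zero] at this
      exact this.symm
    have h1 : ∑ z ∈ Z.parts, ∑ i ∈ z, (Pi.single i (v i) : V → ZMod 2) = v := by
      have := sum_biUnion (s := Z.parts) (t := id) (f := fun i => (Pi.single i (v i) : V → ZMod 2))
        Z.disjoint
      rw [Z.biUnion_parts, univ_sum_single] at this
      exact this.symm
    simp_rw [sum_add_distrib]
    rw [sum_eq_zero h0, add_zero, h1]
  have hP : IsEven Z v ∧ ∀ r, IsPioneer Z S s r → h s (r + v) = h s r := by
    rw [hsum]
    have hadd : ∀ a b : V → ZMod 2,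
        (IsEven Z a ∧ ∀ r, IsPioneer Z S s r → h s (r + a) = h s r) →
        (IsEven Z b ∧ ∀ r, IsPioneer Z S s r → h s (r + b) = h s r) →
        IsEven Z (a + b) ∧ ∀ r, IsPioneer Z S s r → h s (r + (a + b)) = h s r := by
      rintro a b ⟨ha, ha'⟩ ⟨hb, hb'⟩
      exact ⟨ha.add hb, fun r hr => by rw [← add_assoc, hb' _ (hr.add ha), ha' r hr]⟩
    have hzero : IsEven Z 0 ∧ ∀ r, IsPioneer Z S s r → h s (r + 0) = h s r :=
      ⟨fun z _ => by simp, fun r _ => by rw [add_zero]⟩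
    refine sum_induction _ (fun w => IsEven Z w ∧ ∀ r, IsPioneer Z S s r → h s (r + w) = h s r)
      hadd hzero fun z hz => ?_
    refine sum_induction _ (fun w => IsEven Z w ∧ ∀ r, IsPioneer Z S s r → h s (r + w) = h s r)
      hadd hzero fun i hi => ⟨isEven_single_add_single hz hi (hrep z hz) _, fun r hr => ?_⟩
    have hc : ∀ c : ZMod 2, c = 0 ∨ c = 1 := by decide
    rcases hc (v i) with hvi | hvi <;> rw [hvi]
    · simp
    · exact translate_of_block hZS hh hz hi (hrep z hz) s r hr
  exact hP.2 r hsr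

/-- A balanced function is constant on the pioneer pairs. -/
theorem IsBalancedOn.eq_of_isPioneer (hh : IsBalancedOn Z S h) {s t : Finset V}
    {r q : V → ZMod 2} (hsr : IsPioneer Z S s r) (htq : IsPioneer Z S t q) : h t q = h s r := by
  have all : ∀ u : Finset V, ∀ q, IsPioneer Z S (symmDiff s u) q → h (symmDiff s u) q = h s r := by
    intro u
    induction u using Finset.induction with
    | empty =>
      intro q hq
      rw [show (∅ : Finset V) = ⊥ from rfl, symmDiff_bot] at hq ⊢
      have hv : IsEven Z (q - r) := fun z hz => by
        simp [sum_sub_distrib, hq z hz, hsr z hz]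
      rw [← translate_of_isEven hZS hh hv s r hsr, add_sub_cancel]
    | insert a u ha ih =>
      rw [← symmDiff_singleton_of_notMem ha, ← symmDiff_assoc]
      intro q hq
      have hz : Z.part a ∈ Z.parts := Z.part_mem.mpr (mem_univ a)
      have hk : a ∈ Z.part a := Z.mem_part_self.mpr (mem_univ a)
      have h1 := hq.move hZS hz hk
      have h2 := hh.move hZS hq hz hk
      rw [symmDiff_symmDiff_cancel_right] at h1 h2
      rw [← h2, ih _ h1]
  simpa using all (symmDiff s t) q (by simpa using htq)

end Connectivity

/-! ### Comeasurable sets of observables and balanced functions -/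

section Balanced

open Finset

variable {V : Type*}

/-- A function on the omni-joint outcomes is balanced if, for each observer, its mixed second
difference in the directions of the two observables vanishes. -/
def Balanced [DecidableEq V] (g : BinOutcome V → ℝ) : Prop :=
  ∀ (i : V) (γ : BinOutcome V),
    g γ + g (flipAt ⟨i, false⟩ (flipAt ⟨i, true⟩ γ)) =
      g (flipAt ⟨i, false⟩ γ) + g (flipAt ⟨i, true⟩ γ)

variable [DecidableEq V]

lemma mem_pqSet {σ ρ : Finset V} {a : Σ i, BinM V i} :
    a ∈ pqSet σ ρ ↔ a.1 ∈ σ ∧ a.2 = decide (a.1 ∈ ρ) := by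
  obtain ⟨i, b⟩ := a
  simp only [pqSet, restrictContext, contextOf, mem_image]
  constructor
  · rintro ⟨j, hj, hji⟩
    obtain ⟨rfl, h⟩ := Sigma.mk.inj_iff.mp hji
    exact ⟨hj, (eq_of_heq h).symm⟩
  · rintro ⟨hi, hb⟩
    exact ⟨i, hi, by rw [hb]⟩

lemma pqSet_mem_comeasurable (σ ρ : Finset V) : pqSet σ ρ ∈ comeasurable (BinM V) :=
  ⟨contextOf ρ, σ, rfl⟩

lemma pqSet_injOn {σ ρ σ' ρ' : Finset V} (hρ : ρ ⊆ σ) (hρ' : ρ' ⊆ σ')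
    (h : pqSet σ ρ = pqSet σ' ρ') : σ = σ' ∧ ρ = ρ' := by
  have hm : ∀ i b, (i ∈ σ ∧ b = decide (i ∈ ρ)) ↔ (i ∈ σ' ∧ b = decide (i ∈ ρ')) := fun i b => by
    have := Finset.ext_iff.mp h ⟨i, b⟩
    rwa [mem_pqSet, mem_pqSet] at this
  constructor <;> ext i
  · have h1 := hm i true
    have h2 := hm i false
    by_cases hi : i ∈ ρ <;> by_cases hi' : i ∈ ρ' <;> simp_all
  · have h1 := hm i true
    have h2 := @hρ i
    have h3 := @hρ' i
    by_cases hi : i ∈ ρ <;> by_cases hi' : i ∈ ρ' <;> simp_all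

/-- The sets of comeasurable observables contain at most one observable of each observer, and are
the sets `p_{σ \ ρ} q_ρ`. -/
lemma exists_pqSet_eq {τ : Finset (Σ i, BinM V i)}
    (hτ : ∀ i, ¬((⟨i, false⟩ : Σ i, BinM V i) ∈ τ ∧ (⟨i, true⟩ : Σ i, BinM V i) ∈ τ)) :
    ∃ σ ρ : Finset V, ρ ⊆ σ ∧ pqSet σ ρ = τ := by
  refine ⟨τ.image Sigma.fst, (τ.filter fun a => a.2 = true).image Sigma.fst,
    image_subset_image (filter_subset _ _), ?_⟩
  ext ⟨i, b⟩
  have hi := hτ i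
  have e1 : i ∈ τ.image Sigma.fst ↔
      (⟨i, false⟩ : Σ i, BinM V i) ∈ τ ∨ (⟨i, true⟩ : Σ i, BinM V i) ∈ τ := by
    simp only [mem_image, Sigma.exists, Bool.exists_bool, exists_and_right, exists_eq_right]
  have e2 : i ∈ (τ.filter fun a => a.2 = true).image Sigma.fst ↔
      (⟨i, true⟩ : Σ i, BinM V i) ∈ τ := by
    simp
  rw [mem_pqSet]
  simp only [e1, e2]
  cases b <;> simp only [Bool.false_eq, Bool.true_eq, decide_eq_false_iff_not,
    decide_eq_true_eq] <;> tauto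

lemma notMem_comeasurable_iff {τ : Finset (Σ i, BinM V i)} :
    τ ∉ comeasurable (BinM V) ↔
      ∃ i, (⟨i, false⟩ : Σ i, BinM V i) ∈ τ ∧ (⟨i, true⟩ : Σ i, BinM V i) ∈ τ := by
  constructor
  · intro h
    by_contra! hτ
    obtain ⟨σ, ρ, -, rfl⟩ := exists_pqSet_eq (τ := τ) fun i hi => hτ i hi.1 hi.2
    exact h (pqSet_mem_comeasurable σ ρ)
  · rintro ⟨i, h0, h1⟩ ⟨p, σ, rfl⟩
    simp only [restrictContext, mem_image] at h0 h1
    obtain ⟨j, -, hj⟩ := h0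
    obtain ⟨k, -, hk⟩ := h1
    obtain ⟨rfl, hj⟩ := Sigma.mk.inj_iff.mp hj
    obtain ⟨rfl, hk⟩ := Sigma.mk.inj_iff.mp hk
    exact Bool.false_ne_true ((eq_of_heq hj).symm.trans (eq_of_heq hk))

lemma inter_mem_oddOut {z : Finset V} {S : Finset (Finset V)} (hS : S ⊆ z.powerset)
    (s : Finset V) : s ∩ z ∈ oddOut z S ↔ parity S s = 1 := by
  rw [← parity_congr hS (s := s ∩ z) (by rw [inter_assoc, inter_self])]
  rw [oddOut, mem_filter, and_iff_right (mem_powerset.mpr inter_subset_right), parity, sum_boole,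
    ZMod.natCast_eq_one_iff_odd]
  have : S ∩ (s ∩ z).powerset = S.filter fun μ => μ ⊆ s ∩ z := by
    ext μ
    rw [mem_inter, mem_powerset, mem_filter]
  rw [this]

variable [Fintype V]

/-- A function is balanced iff its multideviations vanish on the sets of observables that are not
comeasurable, at any one outcome. -/
lemma forall_multideviation_eq_zero_iff_balanced (g : BinOutcome V → ℝ) (x : BinOutcome V) :
    (∀ τ ∉ comeasurable (BinM V), multideviation g τ x = 0) ↔ Balanced g := by
  constructor
  · intro h i
    refine (forall_multideviation_eq_zero_iff g ⟨i, false⟩ ⟨i, true⟩ x).mp fun τ h0 h1 => ?_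
    exact h τ (notMem_comeasurable_iff.mpr ⟨i, h0, h1⟩)
  · intro h τ hτ
    obtain ⟨i, h0, h1⟩ := notMem_comeasurable_iff.mp hτ
    exact (forall_multideviation_eq_zero_iff g ⟨i, false⟩ ⟨i, true⟩ x).mpr (h i) τ h0 h1

/-! ### Pioneer sets in coordinates -/

/-- The outcome `outcomeEquiv V (s, ρ)` with `ρ` given by its indicator `r` modulo `2`. -/
def outcomeOf (s : Finset V) (r : V → ZMod 2) : BinOutcome V :=
  outcomeEquiv V (s, univ.filter fun i => r i = 1)

lemma exists_outcomeOf_eq (γ : BinOutcome V) : ∃ s r, outcomeOf s r = γ := by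
  obtain ⟨⟨s, ρ⟩, rfl⟩ := (outcomeEquiv V).surjective γ
  refine ⟨s, fun i => if i ∈ ρ then 1 else 0, ?_⟩
  simp [outcomeOf]

lemma flipAt_false_outcomeOf (i : V) (s : Finset V) (r : V → ZMod 2) :
    flipAt ⟨i, false⟩ (outcomeOf s r) = outcomeOf (symmDiff s {i}) r := by
  funext ⟨j, b⟩
  rw [flipAt_apply]
  cases b
  · by_cases hij : j = i
    · subst hij
      by_cases h1 : j ∈ s <;> by_cases h2 : r j = 1 <;>
        simp [outcomeOf, outcomeEquiv, mem_symmDiff, h1, h2]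
    · simp [outcomeOf, outcomeEquiv, mem_symmDiff, hij]
  · simp [outcomeOf, outcomeEquiv]

lemma flipAt_true_outcomeOf (i : V) (s : Finset V) (r : V → ZMod 2) :
    flipAt ⟨i, true⟩ (outcomeOf s r) = outcomeOf (symmDiff s {i}) (r + Pi.single i 1) := by
  have hc : ∀ c : ZMod 2, c = 0 ∨ c = 1 := by decide
  have h2 : (1 + 1 : ZMod 2) = 0 := by decide
  funext ⟨j, b⟩
  rw [flipAt_apply]
  by_cases hij : j = i
  · subst hij
    cases b <;> by_cases h1 : j ∈ s <;> rcases hc (r j) with h | h <;>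
      simp [outcomeOf, outcomeEquiv, mem_symmDiff, h1, h, h2]
  · cases b <;> simp [outcomeOf, outcomeEquiv, mem_symmDiff, hij]

lemma flipAt_flipAt_outcomeOf (i : V) (s : Finset V) (r : V → ZMod 2) :
    flipAt ⟨i, false⟩ (flipAt ⟨i, true⟩ (outcomeOf s r)) = outcomeOf s (r + Pi.single i 1) := by
  rw [flipAt_true_outcomeOf, flipAt_false_outcomeOf, symmDiff_symmDiff_cancel_right]

variable {Z : Finpartition (univ : Finset V)} {S : Finset V → Finset (Finset V)}

lemma outcomeEquiv_mem_pioneerSet (σ ρ : Finset V) :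
    outcomeEquiv V (σ, ρ) ∈ pioneerSet Z S ↔
      ∀ z ∈ Z.parts, (σ ∩ z ∈ oddOut z (S z) ↔ Odd (ρ ∩ z).card) := by
  constructor
  · rintro ⟨σ', ρ', he, h⟩
    obtain ⟨rfl, rfl⟩ := Prod.mk_inj.mp ((outcomeEquiv V).injective he)
    exact h
  · exact fun h => ⟨σ, ρ, rfl, h⟩

lemma outcomeOf_mem_pioneerSet (hZS : IsPioneerProfile Z S) (s : Finset V) (r : V → ZMod 2) :
    outcomeOf s r ∈ pioneerSet Z S ↔ IsPioneer Z S s r := by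
  rw [outcomeOf, outcomeEquiv_mem_pioneerSet]
  refine forall₂_congr fun z hz => ?_
  have hc : ∀ c : ZMod 2, c = if c = 1 then 1 else 0 := by decide
  have hsum : ∑ i ∈ z, r i = (((univ.filter fun i => r i = 1) ∩ z).card : ZMod 2) := by
    rw [sum_congr rfl fun i _ => hc (r i), sum_boole]
    congr 2
    ext i
    simp [and_comm]
  rw [inter_mem_oddOut (hZS.subset z hz), ← ZMod.natCast_eq_one_iff_odd, ← hsum]
  have : ∀ a b : ZMod 2, (a = 1 ↔ b = 1) ↔ b = a := by decide
  exact this _ _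

lemma isBalancedOn_comp_outcomeOf (hZS : IsPioneerProfile Z S) {g : BinOutcome V → ℝ}
    (hg : Balanced g) (hz : ∀ γ ∉ pioneerSet Z S, g γ = 0) :
    IsBalancedOn Z S fun s r => g (outcomeOf s r) where
  eq_zero s r h := hz _ (mt (outcomeOf_mem_pioneerSet hZS s r).mp h)
  balanced i s r := by
    have := hg i (outcomeOf s r)
    rwa [flipAt_flipAt_outcomeOf, flipAt_false_outcomeOf, flipAt_true_outcomeOf] at this

/-- A balanced function that vanishes off a pioneer set is constant on it. -/
lemma Balanced.eq_of_mem_pioneerSet (hZS : IsPioneerProfile Z S) {g : BinOutcome V → ℝ}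
    (hg : Balanced g) (hz : ∀ γ ∉ pioneerSet Z S, g γ = 0) {γ γ' : BinOutcome V}
    (hγ : γ ∈ pioneerSet Z S) (hγ' : γ' ∈ pioneerSet Z S) : g γ' = g γ := by
  obtain ⟨s, r, rfl⟩ := exists_outcomeOf_eq γ
  obtain ⟨t, q, rfl⟩ := exists_outcomeOf_eq γ'
  rw [outcomeOf_mem_pioneerSet hZS] at hγ hγ'
  exact (isBalancedOn_comp_outcomeOf hZS hg hz).eq_of_isPioneer hZS hγ hγ'

lemma exists_eq_mul_indicator (hZS : IsPioneerProfile Z S) {g : BinOutcome V → ℝ}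
    (hg : Balanced g) (hz : ∀ γ ∉ pioneerSet Z S, g γ = 0) :
    ∃ c : ℝ, ∀ γ, g γ = c * (pioneerSet Z S).indicator (fun _ => 1) γ := by
  by_cases hne : (pioneerSet Z S).Nonempty
  · obtain ⟨γ₀, h₀⟩ := hne
    refine ⟨g γ₀, fun γ => ?_⟩
    by_cases hγ : γ ∈ pioneerSet Z S
    · rw [Set.indicator_of_mem hγ, mul_one, hg.eq_of_mem_pioneerSet hZS hz h₀ hγ]
    · rw [Set.indicator_of_notMem hγ, mul_zero, hz γ hγ]
  · exact ⟨0, fun γ => by rw [zero_mul, hz γ fun h => hne ⟨γ, h⟩]⟩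

/-- In the block of `i`, exactly one of the two values of `r i` satisfies the pioneer condition,
whatever the value of `s`. -/
lemma balanced_indicator_pioneerSet (hZS : IsPioneerProfile Z S) :
    Balanced ((pioneerSet Z S).indicator (fun _ => (1 : ℝ))) := by
  intro i γ
  obtain ⟨s, r, rfl⟩ := exists_outcomeOf_eq γ
  rw [flipAt_flipAt_outcomeOf, flipAt_false_outcomeOf, flipAt_true_outcomeOf]
  have hz : Z.part i ∈ Z.parts := Z.part_mem.mpr (mem_univ i)
  have hi : i ∈ Z.part i := Z.mem_part_self.mpr (mem_univ i)
  -- the sum of the two values only depends on the conditions in the other blocks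
  have key : ∀ s, (pioneerSet Z S).indicator (fun _ => (1 : ℝ)) (outcomeOf s r) +
      (pioneerSet Z S).indicator (fun _ => 1) (outcomeOf s (r + Pi.single i 1)) =
      Set.indicator {s | ∀ z ∈ Z.parts, z ≠ Z.part i → ∑ i ∈ z, r i = parity (S z) s}
        (fun _ => 1) s := by
    intro s
    have hoff : ∀ q, IsPioneer Z S s q ↔ (∑ j ∈ Z.part i, q j = parity (S (Z.part i)) s) ∧
        ∀ z ∈ Z.parts, z ≠ Z.part i → ∑ j ∈ z, q j = parity (S z) s := by
      intro q
      refine ⟨fun h => ⟨h _ hz, fun z hz _ => h z hz⟩, fun h z hz => ?_⟩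
      by_cases e : z = Z.part i
      · rw [e]; exact h.1
      · exact h.2 z hz e
    have hother : (∀ z ∈ Z.parts, z ≠ Z.part i →
        ∑ j ∈ z, (r + Pi.single i 1 : V → ZMod 2) j = parity (S z) s) ↔
        ∀ z ∈ Z.parts, z ≠ Z.part i → ∑ j ∈ z, r j = parity (S z) s := by
      refine forall₃_congr fun z hz' e => ?_
      simp only [Pi.add_apply, sum_add_distrib, sum_single_of_part hz hz' hi, if_neg e, add_zero]
    have h0 := hoff r
    have h1 := hoff (r + Pi.single i 1)
    rw [hother] at h1
    simp only [Pi.add_apply, sum_add_distrib, sum_single_of_part hz hz hi, if_true] at h1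
    rw [← outcomeOf_mem_pioneerSet hZS] at h0 h1
    have hc : ∀ a b : ZMod 2, (a = b ∧ a + 1 ≠ b) ∨ (a ≠ b ∧ a + 1 = b) := by decide
    classical
    simp only [Set.indicator_apply, h0, h1, Set.mem_ofPred_eq]
    rcases hc (∑ j ∈ Z.part i, r j) (parity (S (Z.part i)) s) with ⟨e1, e2⟩ | ⟨e1, e2⟩
    · simp [e1]
    · simp [e1, e2]
  rw [key, key]
  have hpar : ∀ z ∈ Z.parts, z ≠ Z.part i → parity (S z) (symmDiff s {i}) = parity (S z) s :=
    fun z hz' e => parity_congr (hZS.subset z hz')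
      (symmDiff_singleton_inter (fun h => e (Z.eq_of_mem_parts hz' hz h hi)) s)
  classical
  simp only [Set.indicator_apply, Set.mem_ofPred_eq]
  congr 1
  refine propext (forall₃_congr fun z hz' e => ?_)
  rw [hpar z hz' e]

/-! ### The tight Bell inequality conditions for pioneer sets -/

theorem tbicFunction_indicator_pioneerSet (hZS : IsPioneerProfile Z S) :
    TBICFunction (pioneerSet Z S) ((pioneerSet Z S).indicator (fun _ => (1 : ℝ))) where
  eq_zero_iff γ := by
    classical
    simp [Set.indicator_apply]
  multideviation_eq_zero τ hτ γ _ :=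
    (forall_multideviation_eq_zero_iff_balanced _ γ).mpr (balanced_indicator_pioneerSet hZS) τ hτ
  pos γ hγ := by
    rw [Set.indicator_of_mem hγ]
    exact one_pos

lemma TBICFunction.balanced {Γ : Set (BinOutcome V)} {g : BinOutcome V → ℝ}
    (hg : TBICFunction Γ g) : Balanced g := by
  by_cases hne : Γ.Nonempty
  · obtain ⟨γ, hγ⟩ := hne
    exact (forall_multideviation_eq_zero_iff_balanced g γ).mp fun τ hτ =>
      hg.multideviation_eq_zero τ hτ γ hγ
  · have : ∀ γ, g γ = 0 := fun γ => (hg.eq_zero_iff γ).mpr fun h => hne ⟨γ, h⟩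
    intro i γ
    simp only [this]

/-- Every block admits both parities of the second set, so a pioneer set is nonempty. -/
lemma pioneerSet_nonempty (hZS : IsPioneerProfile Z S) : (pioneerSet Z S).Nonempty := by
  choose rep hrep using fun z : Z.parts => Z.nonempty_of_mem_parts z.2
  let rep' : V → V := fun i => rep ⟨Z.part i, Z.part_mem.mpr (mem_univ i)⟩
  refine ⟨outcomeOf ∅ fun i => if i = rep' i then parity (S (Z.part i)) ∅ else 0,
    (outcomeOf_mem_pioneerSet hZS _ _).mpr fun z hz => ?_⟩
  have hpart : ∀ i ∈ z, Z.part i = z := fun i hi => Z.part_eq_of_mem hz hi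
  have hterm : ∀ i ∈ z, (if i = rep' i then parity (S (Z.part i)) ∅ else 0) =
      if i = rep ⟨z, hz⟩ then parity (S z) ∅ else 0 := by
    intro i hi
    simp only [rep', hpart i hi]
  rw [sum_congr rfl hterm, sum_ite_eq', if_pos (hrep ⟨z, hz⟩)]

theorem tbic_pioneerSet (hZS : IsPioneerProfile Z S) : TBIC (pioneerSet Z S) where
  exists_function := ⟨_, tbicFunction_indicator_pioneerSet hZS⟩
  unique g g' hg hg' := by
    obtain ⟨c, hc⟩ := exists_eq_mul_indicator hZS hg.balanced fun γ h => (hg.eq_zero_iff γ).mpr h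
    obtain ⟨c', hc'⟩ := exists_eq_mul_indicator hZS hg'.balanced
      fun γ h => (hg'.eq_zero_iff γ).mpr h
    obtain ⟨γ₀, h₀⟩ := pioneerSet_nonempty hZS
    have hpos := hg.pos γ₀ h₀
    rw [hc γ₀, Set.indicator_of_mem h₀, mul_one] at hpos
    refine ⟨c' / c, funext fun γ => ?_⟩
    rw [Pi.smul_apply, smul_eq_mul, hc, hc', ← mul_assoc, div_mul_cancel₀ _ hpos.ne']

end Balanced

/-! ### The multideviations of the indicator of a pioneer set -/

section Coefficients

open Finset

variable {V : Type*} [DecidableEq V]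

/-- A sum over subsets of a function that multiplies up over the elements factorizes. -/
lemma sum_powerset_prod (z : Finset V) (F : V → Bool → ℝ) :
    ∑ r ∈ z.powerset, ∏ i ∈ z, F i (decide (i ∈ r)) = ∏ i ∈ z, (F i true + F i false) := by
  rw [prod_add]
  refine sum_congr rfl fun r hr => ?_
  rw [← prod_sdiff (mem_powerset.mp hr), mul_comm]
  congr 1 <;> refine prod_congr rfl fun i hi => ?_
  · simp [hi]
  · simp [(mem_sdiff.mp hi).2]

/-- The sign `(-1)^b` of a Boolean, where `true` counts as `1`. -/
def sign (b : Bool) : ℝ := if b = true then -1 else 1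

lemma prod_sign_mem {r z : Finset V} (hr : r ⊆ z) :
    ∏ i ∈ z, sign (decide (i ∈ r)) = (-1) ^ r.card := by
  simp only [sign, decide_eq_true_eq]
  rw [prod_ite_mem, inter_eq_right.mpr hr, prod_const]

lemma indicator_iff_odd {c : Prop} [Decidable c] (n : ℕ) :
    (if (c ↔ Odd n) then (1 : ℝ) else 0) = (1 + (-1) ^ (if c then 1 else 0) * (-1) ^ n) / 2 := by
  rcases Nat.even_or_odd n with hn | hn
  · have hn' := Nat.not_odd_iff_even.mpr hn
    by_cases hc : c <;> simp [hc, hn', hn.neg_one_pow]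
  · by_cases hc : c <;> simp [hc, hn, hn.neg_one_pow]

lemma prod_ite_zero_two (z : Finset V) (c : V → Prop) [DecidablePred c] :
    ∏ i ∈ z, (if c i then (0 : ℝ) else 2) = if z.filter c = ∅ then 2 ^ z.card else 0 := by
  split_ifs with h
  · rw [filter_eq_empty_iff] at h
    rw [prod_congr rfl fun i hi => if_neg (h hi), prod_const]
  · obtain ⟨i, hi⟩ := nonempty_iff_ne_empty.mpr h
    exact prod_eq_zero (mem_filter.mp hi).1 (if_pos (mem_filter.mp hi).2)

/-- The contribution of one block to a multideviation: the signed count, over the pairs `(s, r)` of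
subsets of the block, of those that satisfy the pioneer condition. -/
lemma sum_block (z σ ρ : Finset V) (S : Finset (Finset V)) :
    ∑ s ∈ z.powerset, ∑ r ∈ z.powerset, (if (s ∈ oddOut z S ↔ Odd r.card) then (1 : ℝ) else 0) *
      ∏ i ∈ z, (if i ∈ σ then
        (if i ∈ ρ then 1 else sign (decide (i ∈ s))) * sign (decide (i ∈ r)) else 1) =
    4 ^ z.card / 2 * ((if z ∩ σ = ∅ then 1 else 0) +
      1 / 2 ^ z.card * (if z \ σ = ∅ then 1 else 0) *
        ∑ μ ∈ z.powerset, (-1 : ℝ) ^ (μ \ ρ).card *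
          (-1) ^ (if μ ∈ oddOut z S then 1 else 0)) := by
  -- the factors in `s` of the character
  let A : Finset V → ℝ := fun s =>
    ∏ i ∈ z, if i ∈ σ ∧ i ∉ ρ then sign (decide (i ∈ s)) else 1
  have h1 : ∑ r ∈ z.powerset, ∏ i ∈ z, (if i ∈ σ then sign (decide (i ∈ r)) else 1) =
      if z ∩ σ = ∅ then 2 ^ z.card else 0 := by
    rw [sum_powerset_prod z fun i b => if i ∈ σ then sign b else 1, ← filter_mem_eq_inter,
      ← prod_ite_zero_two]
    refine prod_congr rfl fun i _ => ?_
    split_ifs <;> norm_num [sign]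
  have h2 : ∑ r ∈ z.powerset, (-1) ^ r.card *
      ∏ i ∈ z, (if i ∈ σ then sign (decide (i ∈ r)) else 1) =
      if z \ σ = ∅ then 2 ^ z.card else 0 := by
    rw [sum_congr rfl fun r hr => by
      rw [← prod_sign_mem (mem_powerset.mp hr), ← prod_mul_distrib]]
    rw [sum_powerset_prod z fun i b => sign b * if i ∈ σ then sign b else 1,
      ← filter_notMem_eq_sdiff, ← prod_ite_zero_two]
    refine prod_congr rfl fun i _ => ?_
    by_cases hi : i ∈ σ <;> norm_num [sign, hi]
  have hin : ∀ s, ∑ r ∈ z.powerset, (if (s ∈ oddOut z S ↔ Odd r.card) then (1 : ℝ) else 0) *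
      ∏ i ∈ z, (if i ∈ σ then
        (if i ∈ ρ then 1 else sign (decide (i ∈ s))) * sign (decide (i ∈ r)) else 1) =
      A s / 2 * ((if z ∩ σ = ∅ then 2 ^ z.card else 0) +
        (-1) ^ (if s ∈ oddOut z S then 1 else 0) * if z \ σ = ∅ then 2 ^ z.card else 0) := by
    intro s
    rw [← h1, ← h2, mul_sum, ← sum_add_distrib, mul_sum]
    refine sum_congr rfl fun r _ => ?_
    have : ∏ i ∈ z, (if i ∈ σ then
        (if i ∈ ρ then 1 else sign (decide (i ∈ s))) * sign (decide (i ∈ r)) else 1) =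
        A s * ∏ i ∈ z, (if i ∈ σ then sign (decide (i ∈ r)) else 1) := by
      rw [← prod_mul_distrib]
      refine prod_congr rfl fun i _ => ?_
      by_cases hi : i ∈ σ <;> by_cases hi' : i ∈ ρ <;> simp [hi, hi']
    rw [this, indicator_iff_odd]
    ring
  have hA1 : z ∩ σ = ∅ → ∑ s ∈ z.powerset, A s = 2 ^ z.card := by
    intro h
    have : ∀ s, A s = 1 := fun s => prod_eq_one fun i hi => by
      rw [if_neg]
      exact fun hσ => notMem_empty i (h ▸ mem_inter.mpr ⟨hi, hσ.1⟩)
    simp [this, card_powerset]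
  have hA2 : z \ σ = ∅ → ∀ s ∈ z.powerset, A s = (-1) ^ (s \ ρ).card := by
    intro h s hs
    have hs := mem_powerset.mp hs
    rw [← prod_sign_mem (sdiff_subset.trans hs)]
    refine prod_congr rfl fun i hi => ?_
    have hσ : i ∈ σ := sdiff_eq_empty_iff_subset.mp h hi
    by_cases h1 : i ∈ s <;> by_cases h2 : i ∈ ρ <;> simp [hσ, h1, h2, sign]
  simp_rw [hin, mul_add, sum_add_distrib]
  have h4 : (4 : ℝ) ^ z.card = 2 ^ z.card * 2 ^ z.card := by rw [← mul_pow]; norm_num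
  rw [h4]
  congr 1
  · split_ifs with h
    · rw [← sum_mul, ← sum_div, hA1 h]
      ring
    · simp
  · split_ifs with h
    · rw [sum_congr rfl fun s hs => by rw [hA2 h s hs], mul_sum, mul_sum]
      refine sum_congr rfl fun s _ => ?_
      field_simp
    · simp

lemma character_pqSet (σ ρ : Finset V) (γ : BinOutcome V) :
    character (pqSet σ ρ) γ = ∏ i ∈ σ, sign (γ ⟨i, decide (i ∈ ρ)⟩) := by
  rw [pqSet, restrictContext, character, prod_image]
  · rfl
  · intro i _ j _ h
    exact (Sigma.mk.inj_iff.mp h).1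

variable [Fintype V]

/-- A sum over subsets of `V` of a product of functions of the traces on the blocks of a partition
is the product of the sums over the subsets of the blocks. -/
lemma sum_prod_inter_parts (Z : Finpartition (univ : Finset V))
    (F : Finset V → Finset V → ℝ) :
    ∑ s : Finset V, ∏ z ∈ Z.parts, F z (s ∩ z) = ∏ z ∈ Z.parts, ∑ t ∈ z.powerset, F z t := by
  rw [prod_sum]
  refine sum_bij' (fun s _ z _ => s ∩ z)
    (fun p _ => Z.parts.attach.biUnion fun z => p z.1 z.2) ?_ ?_ ?_ ?_ ?_
  · exact fun s _ => mem_pi.mpr fun z _ => mem_powerset.mpr inter_subset_right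
  · exact fun _ _ => mem_univ _
  · intro s _
    ext i
    simp only [mem_biUnion, mem_attach, true_and, Subtype.exists, mem_inter]
    exact ⟨fun ⟨_, _, h, _⟩ => h, fun h => ⟨Z.part i, Z.part_mem.mpr (mem_univ i), h,
      Z.mem_part_self.mpr (mem_univ i)⟩⟩
  · intro p hp
    have hp := fun z hz => mem_powerset.mp (mem_pi.mp hp z hz)
    funext z hz
    ext i
    simp only [mem_biUnion, mem_attach, true_and, Subtype.exists, mem_inter]
    constructor
    · rintro ⟨⟨z', hz', hi⟩, hiz⟩
      obtain rfl := Z.eq_of_mem_parts hz' hz (hp z' hz' hi) hiz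
      exact hi
    · exact fun hi => ⟨⟨z, hz, hi⟩, hp z hz hi⟩
  · exact fun s _ => (prod_attach Z.parts fun z => F z (s ∩ z)).symm

lemma prod_parts_prod (Z : Finpartition (univ : Finset V)) (g : V → ℝ) :
    ∏ z ∈ Z.parts, ∏ i ∈ z, g i = ∏ i, g i := by
  have := prod_biUnion (s := Z.parts) (t := id) (f := g) Z.disjoint
  rw [Z.biUnion_parts] at this
  exact this.symm

variable {Z : Finpartition (univ : Finset V)} {S : Finset V → Finset (Finset V)}

/-- The indicator of a pioneer set and the characters factorize over the blocks. -/
lemma indicator_mul_character (σ ρ s r : Finset V) :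
    (pioneerSet Z S).indicator (fun _ => (1 : ℝ)) (outcomeEquiv V (s, r)) *
      character (pqSet σ ρ) (outcomeEquiv V (s, r)) =
    ∏ z ∈ Z.parts, ((if (s ∩ z ∈ oddOut z (S z) ↔ Odd (r ∩ z).card) then (1 : ℝ) else 0) *
      ∏ i ∈ z, (if i ∈ σ then (if i ∈ ρ then 1 else sign (decide (i ∈ s ∩ z))) *
        sign (decide (i ∈ r ∩ z)) else 1)) := by
  rw [prod_mul_distrib]
  congr 1
  · classical
    rw [Set.indicator_apply, prod_ite_zero]
    simp only [outcomeEquiv_mem_pioneerSet, prod_const_one]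
  · have : ∀ z ∈ Z.parts, ∏ i ∈ z, (if i ∈ σ then (if i ∈ ρ then 1 else
        sign (decide (i ∈ s ∩ z))) * sign (decide (i ∈ r ∩ z)) else 1) =
        ∏ i ∈ z, (if i ∈ σ then (if i ∈ ρ then 1 else
          sign (decide (i ∈ s))) * sign (decide (i ∈ r)) else 1) :=
      fun z _ => prod_congr rfl fun i hi => by simp [hi]
    rw [prod_congr rfl this, prod_parts_prod Z, character_pqSet, prod_ite_mem, univ_inter]
    refine prod_congr rfl fun i _ => ?_
    by_cases h1 : i ∈ ρ <;> by_cases h2 : i ∈ s <;> by_cases h3 : i ∈ r <;>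
      simp [outcomeEquiv, mem_symmDiff, h1, h2, h3, sign]

theorem multideviation_indicator_pioneerSet (σ ρ : Finset V) :
    multideviation ((pioneerSet Z S).indicator fun _ => (1 : ℝ)) (pqSet σ ρ) (allOnes V) =
      1 / 2 ^ Z.parts.card * ∏ z ∈ Z.parts,
        ((if z ∩ σ = ∅ then 1 else 0) +
          1 / 2 ^ z.card * (if z \ σ = ∅ then 1 else 0) *
            ∑ μ ∈ z.powerset, (-1 : ℝ) ^ (μ \ ρ).card *
              (-1) ^ (if μ ∈ oddOut z (S z) then 1 else 0)) := by
  refine (multideviation_eq _ _ _).trans ?_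
  have hsum : ∑ γ : BinOutcome V, (pioneerSet Z S).indicator (fun _ => (1 : ℝ)) γ *
      character (pqSet σ ρ) γ = ∏ z ∈ Z.parts, (4 ^ z.card / 2 *
        ((if z ∩ σ = ∅ then 1 else 0) + 1 / 2 ^ z.card * (if z \ σ = ∅ then 1 else 0) *
            ∑ μ ∈ z.powerset, (-1 : ℝ) ^ (μ \ ρ).card *
              (-1) ^ (if μ ∈ oddOut z (S z) then 1 else 0))) := by
    rw [← (outcomeEquiv V).sum_comp, Fintype.sum_prod_type]
    simp_rw [indicator_mul_character]
    rw [sum_congr rfl fun s _ => sum_prod_inter_parts Z fun z r =>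
      (if (s ∩ z ∈ oddOut z (S z) ↔ Odd r.card) then (1 : ℝ) else 0) *
        ∏ i ∈ z, (if i ∈ σ then (if i ∈ ρ then 1 else sign (decide (i ∈ s ∩ z))) *
          sign (decide (i ∈ r)) else 1)]
    rw [sum_prod_inter_parts Z fun z s => ∑ r ∈ z.powerset,
      (if (s ∈ oddOut z (S z) ↔ Odd r.card) then (1 : ℝ) else 0) *
        ∏ i ∈ z, (if i ∈ σ then (if i ∈ ρ then 1 else sign (decide (i ∈ s))) *
          sign (decide (i ∈ r)) else 1)]
    exact prod_congr rfl fun z _ => sum_block z σ ρ (S z)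
  have hcard : ∏ z ∈ Z.parts, ((4 : ℝ) ^ z.card / 2) =
      2 ^ (2 * Fintype.card V) / 2 ^ Z.parts.card := by
    rw [prod_div_distrib, prod_const, prod_pow_eq_pow_sum, Z.sum_card_parts, card_univ, pow_mul]
    norm_num
  have hobs : Fintype.card (Σ i, BinM V i) = 2 * Fintype.card V := by simp [mul_comm]
  rw [hobs]
  have hχ : character (pqSet σ ρ) (allOnes V) = 1 := character_const_false _
  rw [hχ]
  refine (congrArg _ hsum).trans ?_
  rw [prod_mul_distrib, hcard]
  field_simp

end Coefficients

/-! ### The Bell form on deterministic distributions -/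

section Form

open Finset

variable {V : Type*} [DecidableEq V] [Fintype V]

lemma isLinearMap_bellForm (f : BinOutcome V → ℝ) : IsLinearMap ℝ (bellForm f) where
  map_add P Q := by
    simp only [bellForm, multideviation, Pi.add_apply, add_mul, mul_add, sum_add_distrib]
  map_smul c P := by
    simp only [bellForm, multideviation, Pi.smul_apply, smul_eq_mul, mul_sum]
    refine sum_congr rfl fun σ _ => sum_congr rfl fun ρ _ => sum_congr rfl fun y _ => ?_
    ring

lemma multideviation_deterministic (γ : BinOutcome V) (σ ρ : Finset V) :
    multideviation (deterministic γ (contextOf ρ)) σ (fun _ => false) =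
      (2 ^ Fintype.card V)⁻¹ * character (pqSet σ ρ) γ := by
  refine (multideviation_eq (B := V) _ σ _).trans ?_
  rw [character_const_false, mul_one]
  congr 1
  simp only [deterministic, ite_mul, one_mul, zero_mul]
  rw [character_pqSet]
  exact (sum_ite_eq' univ (fun i => γ ⟨i, contextOf ρ i⟩)
    (fun y : V → Bool => character σ y)).trans (if_pos (mem_univ _))

/-- For a balanced `f`, the Bell form at a deterministic distribution is Fourier inversion, as the
sets `p_{σ \ ρ} q_ρ` are the only ones with a nonzero coefficient. -/
theorem bellForm_deterministic {f : BinOutcome V → ℝ} (hf : Balanced f) (γ : BinOutcome V) :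
    2 ^ Fintype.card V * bellForm f (deterministic γ) = f γ := by
  have hvanish := (forall_multideviation_eq_zero_iff_balanced f (allOnes V)).mpr hf
  have hinv : f γ = ∑ τ, multideviation f τ (allOnes V) * character τ γ := by
    refine (sum_multideviation f γ).symm.trans (sum_congr rfl fun τ _ => ?_)
    refine (multideviation_eq f τ γ).trans ?_
    rw [show multideviation f τ (allOnes V) = _ from multideviation_eq f τ (allOnes V),
      show character τ (allOnes V) = 1 from character_const_false τ]
    ring
  have hform : 2 ^ Fintype.card V * bellForm f (deterministic γ) =
      ∑ σ : Finset V, ∑ ρ ∈ σ.powerset,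
        multideviation f (pqSet σ ρ) (allOnes V) * character (pqSet σ ρ) γ := by
    simp only [bellForm, multideviation_deterministic, mul_sum]
    refine sum_congr rfl fun σ _ => sum_congr rfl fun ρ _ => ?_
    field_simp
  rw [hform, hinv, sum_sigma']
  refine sum_of_injOn (fun x => pqSet x.1 x.2) ?_ (fun _ _ => mem_univ _) ?_ (fun _ _ => rfl)
  · rintro ⟨σ, ρ⟩ h ⟨σ', ρ'⟩ h' heq
    simp only [coe_sigma, Set.mem_sigma_iff, mem_coe, mem_powerset] at h h'
    obtain ⟨rfl, rfl⟩ := pqSet_injOn h.2 h'.2 heq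
    rfl
  · intro τ _ hτ
    rw [hvanish τ, zero_mul]
    rw [notMem_comeasurable_iff]
    by_contra! hc
    obtain ⟨σ, ρ, hρ, rfl⟩ := exists_pqSet_eq (τ := τ) fun i hi => hc i hi.1 hi.2
    exact hτ ⟨⟨σ, ρ⟩, by simpa using hρ, rfl⟩

theorem sum_mul_eq_bellForm {f : BinOutcome V → ℝ} (hf : Balanced f) (w : BinOutcome V → ℝ) :
    ∑ γ, f γ * w γ = 2 ^ Fintype.card V * bellForm f (∑ γ, w γ • deterministic γ) := by
  have := map_sum (isLinearMap_bellForm f).mk' (fun γ => w γ • deterministic γ) univ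
  simp only [map_smul, IsLinearMap.mk'_apply, smul_eq_mul] at this
  rw [this, mul_sum]
  refine sum_congr rfl fun γ _ => ?_
  rw [mul_left_comm, bellForm_deterministic hf, mul_comm]

/-! ### Facets of the Bell polytope -/

omit [DecidableEq V] in
lemma deterministic_congr {γ γ' : BinOutcome V} {p : Context (BinM V)}
    (h : ∀ i, γ ⟨i, p i⟩ = γ' ⟨i, p i⟩) :
    deterministic γ p = deterministic γ' p := by
  funext x
  simp only [deterministic, h]

lemma deterministic_flipAt {i : V} {b : Bool} {p : Context (BinM V)} (hp : p i ≠ b)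
    (γ : BinOutcome V) : deterministic (flipAt ⟨i, b⟩ γ) p = deterministic γ p := by
  refine deterministic_congr fun j => ?_
  rw [flipAt_apply, if_neg]
  intro h
  obtain ⟨rfl, h⟩ := Sigma.mk.inj_iff.mp h
  exact hp (eq_of_heq h)

/-- In each context, an observer measures only one of the two observables, so linear functionals of
deterministic distributions are balanced. -/
lemma balanced_deterministic (ψ : Behavior (BinM V) (BinN V) →ₗ[ℝ] ℝ) (c : ℝ) :
    Balanced fun γ => ψ (deterministic γ) - c := by
  intro i γ
  have h : deterministic γ + deterministic (flipAt ⟨i, false⟩ (flipAt ⟨i, true⟩ γ)) =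
      deterministic (M := BinM V) (N := BinN V) (flipAt ⟨i, false⟩ γ) +
        deterministic (flipAt ⟨i, true⟩ γ) := by
    funext p
    rw [Pi.add_apply, Pi.add_apply]
    cases hp : p i
    · rw [flipAt_comm, deterministic_flipAt (b := true) (by simp [hp]),
        deterministic_flipAt (b := true) (by simp [hp]), add_comm]
    · rw [deterministic_flipAt (b := false) (by simp [hp]),
        deterministic_flipAt (b := false) (by simp [hp])]
  have := congrArg ψ h
  simp only [map_add] at this
  simp only
  linarith

omit [DecidableEq V] in
/-- If `ℓ` is nonnegative on the deterministic distributions, and every linear functional that is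
constant on those with `ℓ = 0` is, up to that constant, a multiple of `ℓ` on all of them, then
`0 ≤ ℓ` is tight: the direction of the face is the kernel of `ℓ` in the direction of the
polytope. -/
theorem isTightBellInequality_of_forall_dual {ℓ : Behavior (BinM V) (BinN V) → ℝ}
    (hℓ : IsLinearMap ℝ ℓ) (hpos : ∀ γ, 0 ≤ ℓ (deterministic γ))
    {γ₀ γ₁ : BinOutcome V} (h₀ : ℓ (deterministic γ₀) = 0) (h₁ : ℓ (deterministic γ₁) ≠ 0)
    (hdual : ∀ ψ : Behavior (BinM V) (BinN V) →ₗ[ℝ] ℝ,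
      (∀ γ, ℓ (deterministic γ) = 0 → ψ (deterministic γ) = ψ (deterministic γ₀)) →
      ∃ c, ∀ γ, ψ (deterministic γ) - ψ (deterministic γ₀) = c * ℓ (deterministic γ)) :
    IsTightBellInequality ℓ := by
  have hmem : ∀ γ : BinOutcome V, deterministic γ ∈ bellPolytope (BinM V) (BinN V) :=
    fun γ => subset_convexHull ℝ _ ⟨γ, rfl⟩
  set L := hℓ.mk'
  have hLℓ : ∀ P, L P = ℓ P := fun P => rfl
  set F := {P ∈ bellPolytope (BinM V) (BinN V) | ℓ P = 0}
  set D := vectorSpan ℝ (bellPolytope (BinM V) (BinN V)) with hD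
  have hD_span : D = Submodule.span ℝ (Set.range fun γ : BinOutcome V =>
      deterministic γ - deterministic γ₀) := by
    rw [hD, bellPolytope, ← direction_affineSpan, affineSpan_convexHull, direction_affineSpan,
      vectorSpan_range_eq_span_range_vsub_right ℝ _ γ₀]
    rfl
  have hle : vectorSpan ℝ F ≤ D := vectorSpan_mono ℝ fun P hP => hP.1
  have hker : (vectorSpan ℝ F).comap D.subtype = LinearMap.ker (L.domRestrict D) := by
    ext ⟨v, hv⟩
    simp only [Submodule.mem_comap, Submodule.subtype_apply, LinearMap.mem_ker,
      LinearMap.domRestrict_apply]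
    constructor
    · intro h
      have : vectorSpan ℝ F ≤ LinearMap.ker L := by
        rw [vectorSpan, Submodule.span_le]
        rintro _ ⟨P, hP, Q, hQ, rfl⟩
        change L (P - Q) = 0
        rw [map_sub, hLℓ, hLℓ, hP.2, hQ.2, sub_zero]
      exact this h
    · intro h
      -- a functional that separates `v` from the direction of the face is a multiple of `ℓ`
      by_contra hvF
      obtain ⟨ψ, hψv, hψ⟩ := Submodule.exists_le_ker_of_notMem hvF
      obtain ⟨c, hc⟩ := hdual ψ fun γ hγ => by
        have := hψ (vsub_mem_vectorSpan ℝ (s := F) ⟨hmem γ, hγ⟩ ⟨hmem γ₀, h₀⟩)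
        rwa [vsub_eq_sub, LinearMap.mem_ker, map_sub, sub_eq_zero] at this
      have hDc : D ≤ LinearMap.ker (ψ - c • L) := by
        rw [hD_span, Submodule.span_le]
        rintro _ ⟨γ, rfl⟩
        simp only [SetLike.mem_coe, LinearMap.mem_ker, LinearMap.sub_apply, LinearMap.smul_apply,
          map_sub, hLℓ, h₀, smul_eq_mul]
        linarith [hc γ]
      have := hDc hv
      simp only [LinearMap.mem_ker, LinearMap.sub_apply, LinearMap.smul_apply, h, smul_zero,
        sub_zero] at this
      exact hψv this
  have hsurj : LinearMap.range (L.domRestrict D) = ⊤ := by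
    refine LinearMap.range_eq_top.mpr (LinearMap.surjective fun h => h₁ ?_)
    have : L (deterministic γ₁ - deterministic γ₀) = 0 := LinearMap.congr_fun h
      ⟨_, vsub_mem_vectorSpan ℝ (hmem γ₁) (hmem γ₀)⟩
    rwa [map_sub, hLℓ, hLℓ, h₀, sub_zero] at this
  refine ⟨hℓ, fun P hP => ?_, ⟨deterministic γ₀, hmem γ₀, h₀⟩, ?_⟩
  · have hconv : Convex ℝ {P | 0 ≤ ℓ P} := convex_halfSpace_ge hℓ 0
    refine convexHull_min ?_ hconv hP
    rintro _ ⟨γ, rfl⟩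
    exact hpos γ
  · rw [← LinearMap.finrank_range_add_finrank_ker (L.domRestrict D), hsurj, ← hker,
      (Submodule.comapSubtypeEquivOfLe hle).finrank_eq, finrank_top, Module.finrank_self,
      add_comm]

variable {Z : Finpartition (univ : Finset V)} {S : Finset V → Finset (Finset V)}

/-- Reversing both outcomes of an observer takes an outcome in the pioneer set out of it. -/
lemma exists_notMem_pioneerSet [Nonempty V] (hZS : IsPioneerProfile Z S) :
    ∃ γ, γ ∉ pioneerSet Z S := by
  obtain ⟨i⟩ := ‹Nonempty V›
  obtain ⟨γ, hγ⟩ := pioneerSet_nonempty hZS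
  obtain ⟨s, r, rfl⟩ := exists_outcomeOf_eq γ
  rw [outcomeOf_mem_pioneerSet hZS] at hγ
  exact ⟨_, mt (outcomeOf_mem_pioneerSet hZS s _).mp (not_isPioneer_add_single hγ
    (Z.part_mem.mpr (mem_univ i)) (Z.mem_part_self.mpr (mem_univ i)))⟩

theorem isTightBellInequality_pioneerSet [Nonempty V] (hZS : IsPioneerProfile Z S) :
    IsTightBellInequality (bellForm ((pioneerSet Z S).indicator fun _ => (1 : ℝ))) := by
  set f := (pioneerSet Z S).indicator fun _ => (1 : ℝ) with hf
  have hbal : Balanced f := balanced_indicator_pioneerSet hZS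
  have hval : ∀ γ, bellForm f (deterministic γ) = f γ / 2 ^ Fintype.card V := fun γ => by
    rw [← bellForm_deterministic hbal γ]
    field_simp
  obtain ⟨γ₀, h₀⟩ := exists_notMem_pioneerSet hZS
  obtain ⟨γ₁, h₁⟩ := pioneerSet_nonempty hZS
  have hoff : ∀ γ ∉ pioneerSet Z S, f γ = 0 := fun γ hγ => Set.indicator_of_notMem hγ _
  refine isTightBellInequality_of_forall_dual (γ₀ := γ₀) (γ₁ := γ₁) (isLinearMap_bellForm f)
    (fun γ => ?_) ?_ ?_ fun ψ hψ => ?_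
  · rw [hval]
    exact div_nonneg (Set.indicator_nonneg (fun _ _ => zero_le_one) γ) (by positivity)
  · rw [hval, hoff γ₀ h₀, zero_div]
  · rw [hval, hf, Set.indicator_of_mem h₁]
    positivity
  · obtain ⟨c, hc⟩ := exists_eq_mul_indicator hZS
      (balanced_deterministic ψ (ψ (deterministic γ₀))) fun γ hγ => by
        rw [sub_eq_zero]
        exact hψ γ (by rw [hval, hoff γ hγ, zero_div])
    refine ⟨c * 2 ^ Fintype.card V, fun γ => ?_⟩
    rw [hc, hval]
    field_simp
    rfl

end Form

end Bell

theorem mainTheorem4 {V : Type*} [Fintype V] [DecidableEq V] [Nonempty V]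
    (Z : Finpartition (Finset.univ : Finset V)) (S : Finset V → Finset (Finset V))
    (hZS : Bell.IsPioneerProfile Z S) (f : Bell.BinOutcome V → ℝ)
    (hf : f = Set.indicator (Bell.pioneerSet Z S) (fun _ => 1)) :
    -- the pioneer set satisfies the tight Bell inequality conditions, with `f` its function
    Bell.TBIC (Bell.pioneerSet Z S) ∧
    Bell.TBICFunction (Bell.pioneerSet Z S) f ∧
    -- the multideviation coefficients
    (∀ σ ρ : Finset V, ρ ⊆ σ →
      Bell.multideviation f (Bell.pqSet σ ρ) (Bell.allOnes V) =
        1 / 2 ^ Z.parts.card * ∏ z ∈ Z.parts,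
          ((if z ∩ σ = ∅ then 1 else 0) +
            1 / 2 ^ z.card * (if z \ σ = ∅ then 1 else 0) *
              ∑ μ ∈ z.powerset, (-1 : ℝ) ^ (μ \ ρ).card *
                (-1) ^ (if μ ∈ Bell.oddOut z (S z) then 1 else 0))) ∧
    -- on (signed) mixtures of deterministic distributions the inequality reads `∑ f(γ) w(γ) ≥ 0`
    (∀ w : Bell.BinOutcome V → ℝ,
      ∑ γ, f γ * w γ =
        2 ^ Fintype.card V * Bell.bellForm f (∑ γ, w γ • Bell.deterministic γ)) ∧
    -- the inequality with these coefficients is a tight Bell inequality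
    Bell.IsTightBellInequality (Bell.bellForm f) := by
  subst hf
  exact ⟨Bell.tbic_pioneerSet hZS, Bell.tbicFunction_indicator_pioneerSet hZS,
    fun σ ρ _ => Bell.multideviation_indicator_pioneerSet σ ρ,
    Bell.sum_mul_eq_bellForm (Bell.balanced_indicator_pioneerSet hZS),
    Bell.isTightBellInequality_pioneerSet hZS⟩
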